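/- Let $R$ be a commutative ring and let $\mathbf{D}(R)$ be the unbounded derived category of $R$-modules. A full triangulated subcategory of $\mathbf{D}(R)$ is called localizing if it is closed under arbitrary (small) coproducts, and for a class $\mathcal{C}$ of objects of $\mathbf{D}(R)$ we write $\mathrm{Loc}(\mathcal{C})$ for the smallest localizing subcategory containing $\mathcal{C}$ (and $\mathrm{Loc}(X)$ if $\mathcal{C}=\{X\}$). An object $C$ is compact if $\mathrm{Hom}_{\mathbf{D}(R)}(C,-)$ commutes with coproducts; a morphism $\varphi$ is a phantom if $\mathrm{Hom}_{\mathbf{D}(R)}(C,\varphi)=0$ for every compact $C$; a morphism $f\colon X\to Y$ is a pure monomorphism if it fits in a distinguished triangle $X\xrightarrow{f}Y\to Z\xrightarrow{\delta}X[1]$ in which $\delta$ is a phantom; an object $E$ is pure-injective if every pure monomorphism $E\to Y$ splits. Let $\mathcal{I}$ be the full subcategory of all pure-injective objects of $\mathbf{D}(R)$. Suppose that $\mathrm{Loc}(\mathcal{I})=\mathbf{D}(R)$. Then for every faithfully flat homomorphism $R\to S$ of commutative rings, $\mathrm{Loc}(S)=\mathbf{D}(R)$, where $S$ is viewed, via $R\to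 S$, as an object of $\mathbf{D}(R)$ concentrated in degree $0$. -/

import Mathlib

open CategoryTheory CategoryTheory.Limits CategoryTheory.Pretriangulated

universe w u

noncomputable section

namespace PureDerived

variable {R : Type u} [CommRing R] [HasDerivedCategory.{w} (ModuleCat.{u} R)]

open Classical in
/-- An object `C` of `D(R)` is compact if `Hom(C, -)` commutes with (small) coproducts: for every
coproduct `∐ X i` in `D(R)`, the canonical map `⨁ i, Hom(C, X i) → Hom(C, ∐ X i)` is bijective. -/
def IsCompactObject (C : DerivedCategory (ModuleCat.{u} R)) : Prop :=
  ∀ (ι : Type u) (X : ι → DerivedCategory (ModuleCat.{u} R)) (c : Cofan X), IsColimit c →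
    Function.Bijective
      (DirectSum.toAddMonoid (fun i => Preadditive.rightComp C (c.inj i)) :
        (DirectSum ι fun i => (C ⟶ X i)) →+ (C ⟶ c.pt))

/-- A morphism `φ` of `D(R)` is a phantom if `Hom(C, φ) = 0` for every compact object `C`. -/
def IsPhantom {U V : DerivedCategory (ModuleCat.{u} R)} (φ : U ⟶ V) : Prop :=
  ∀ C : DerivedCategory (ModuleCat.{u} R), IsCompactObject C → ∀ f : C ⟶ U, f ≫ φ = 0

/-- A distinguished triangle `X ⟶ Y ⟶ Z ⟶ X⟦1⟧` of `D(R)` is pure if its connecting morphism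
`Z ⟶ X⟦1⟧` is a phantom. -/
def IsPureTriangle (T : Triangle (DerivedCategory (ModuleCat.{u} R))) : Prop :=
  T ∈ distTriang (DerivedCategory (ModuleCat.{u} R)) ∧ IsPhantom T.mor₃

/-- A morphism of `D(R)` is a pure monomorphism if it is the first morphism of a pure triangle. -/
def IsPureMono {X Y : DerivedCategory (ModuleCat.{u} R)} (f : X ⟶ Y) : Prop :=
  ∃ (Z : DerivedCategory (ModuleCat.{u} R)) (g : Y ⟶ Z) (δ : Z ⟶ X⟦(1 : ℤ)⟧),
    IsPureTriangle (Triangle.mk f g δ)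

/-- An object `E` of `D(R)` is pure-injective if every pure monomorphism `E ⟶ Y` splits. -/
def IsPureInjective (E : DerivedCategory (ModuleCat.{u} R)) : Prop :=
  ∀ (Y : DerivedCategory (ModuleCat.{u} R)) (f : E ⟶ Y), IsPureMono f → IsSplitMono f

/-- The full subcategory of pure-injective objects of `D(R)`. -/
def pureInjectives (R : Type u) [CommRing R] [HasDerivedCategory.{w} (ModuleCat.{u} R)] :
    ObjectProperty (DerivedCategory (ModuleCat.{u} R)) :=
  fun E => IsPureInjective E

/-- A full subcategory of `D(R)` is localizing if it is a (strictly full) triangulated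
subcategory that is closed under (small) coproducts. -/
structure IsLocalizing (P : ObjectProperty (DerivedCategory (ModuleCat.{u} R))) : Prop where
  isTriangulated : P.IsTriangulated
  isClosedUnderIsomorphisms : P.IsClosedUnderIsomorphisms
  coproducts (ι : Type u) : P.IsClosedUnderColimitsOfShape (Discrete ι)

/-- `Loc(P)`: the smallest localizing subcategory of `D(R)` that contains `P`. -/
def Loc (P : ObjectProperty (DerivedCategory (ModuleCat.{u} R))) :
    ObjectProperty (DerivedCategory (ModuleCat.{u} R)) :=
  fun X => ∀ Q : ObjectProperty (DerivedCategory (ModuleCat.{u} R)),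
    IsLocalizing Q → P ≤ Q → Q X

/-- An `R`-module, regarded as an object of `D(R)` concentrated in degree `0`. -/
abbrev moduleObj (R : Type u) [CommRing R] [HasDerivedCategory.{w} (ModuleCat.{u} R)]
    (M : Type u) [AddCommGroup M] [Module R M] : DerivedCategory (ModuleCat.{u} R) :=
  (DerivedCategory.singleFunctor (ModuleCat.{u} R) 0).obj (ModuleCat.of R M)

end PureDerived

end

/-! By faithful flatness, `0 → R → S → S/R → 0` splits after base change to `S`, and descent makes
`S/R` flat. Hence for every complex `E` there is a triangle `E → E ⊗ S → E ⊗ S/R → E[1]`, and its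
connecting morphism is a phantom (`IsFlatExact.isPhantom`). A pure-injective `X` is therefore a
retract of `X ⊗ S`. As `X` lies in `Loc(R) = D(R)`, the object `X ⊗ S` lies in `Loc(S)`; closure
under retracts puts `X` there too, and the pure-injectives generate.

The phantom property is derived directly from the definition of compactness, without identifying
compact objects with perfect complexes. The key is that for `M` flat with free cover `F → M` and
syzygy `ΩM`, a map `x : A → E ⊗ M` from a compact `A` factors through `E ⊗ F`
(`IsFlatExact.exists_lift`). The obstruction is `x ≫ δ : A → (E ⊗ ΩM)[1]`. If it lifted to the free
cover of `ΩM`, it would involve finitely many elements of `ΩM`; some map `F → ΩM` fixes these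
because `M` is flat, and this forces `x ≫ δ = 0`. So an unliftable `x` produces an unliftable `x ≫
δ`, and so on along an infinite sequence of ghosts. But the homotopy colimit of ghosts vanishes, so
maps from a compact object die at a finite stage (`IsCompactObject.exists_eq_zero_of_isGhost`). -/

noncomputable section

namespace PureDerived

/-! ### Projections from a coproduct -/

section Cofan

variable {C : Type*} [Category* C] [HasZeroMorphisms C] {ι : Type*} {X : ι → C}

open Classical in
/-- The projection from a coproduct onto one of its summands. -/
def cofanπ {c : Cofan X} (hc : IsColimit c) (j : ι) : c.pt ⟶ X j :=
  Cofan.IsColimit.desc hc fun i => if h : i = j then eqToHom (congrArg X h) else 0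

@[simp]
lemma inj_cofanπ_self {c : Cofan X} (hc : IsColimit c) (j : ι) :
    c.inj j ≫ cofanπ hc j = 𝟙 _ := by
  simp [cofanπ]

lemma inj_cofanπ_ne {c : Cofan X} (hc : IsColimit c) {i j : ι} (h : i ≠ j) :
    c.inj i ≫ cofanπ hc j = 0 := by
  simp [cofanπ, h]

end Cofan

/-! ### Exactness of Hom along a triangle -/

section Triangles

variable {C : Type*} [Category* C] [HasZeroObject C] [HasShift C ℤ] [Preadditive C]
  [∀ n : ℤ, (shiftFunctor C n).Additive] [Pretriangulated C] {X Y Z : C} {f : X ⟶ Y} {g : Y ⟶ Z}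
  {h : Z ⟶ X⟦(1 : ℤ)⟧} (hT : Triangle.mk f g h ∈ distTriang C)

include hT

lemma comp_eq_zero₁₂ : f ≫ g = 0 := comp_distTriang_mor_zero₁₂ _ hT

lemma comp_eq_zero₂₃ : g ≫ h = 0 := comp_distTriang_mor_zero₂₃ _ hT

lemma comp_eq_zero₃₁ : h ≫ f⟦(1 : ℤ)⟧' = 0 := comp_distTriang_mor_zero₃₁ _ hT

lemma exists_lift₁ {A : C} (a : A ⟶ Y) (ha : a ≫ g = 0) : ∃ b : A ⟶ X, a = b ≫ f :=
  Triangle.coyoneda_exact₂ _ hT a ha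

lemma exists_lift₂ {A : C} (a : A ⟶ Z) (ha : a ≫ h = 0) : ∃ b : A ⟶ Y, a = b ≫ g :=
  Triangle.coyoneda_exact₃ _ hT a ha

lemma exists_desc₃ {A : C} (a : Y ⟶ A) (ha : f ≫ a = 0) : ∃ b : Z ⟶ A, a = g ≫ b :=
  Triangle.yoneda_exact₂ _ hT a ha

lemma exists_desc₁ {A : C} (a : Z ⟶ A) (ha : g ≫ a = 0) :
    ∃ b : X⟦(1 : ℤ)⟧ ⟶ A, a = h ≫ b :=
  Triangle.yoneda_exact₃ _ hT a ha

lemma exists_desc_shift {A : C} (a : X⟦(1 : ℤ)⟧ ⟶ A) (ha : h ≫ a = 0) :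
    ∃ b : Y⟦(1 : ℤ)⟧ ⟶ A, a = f⟦(1 : ℤ)⟧' ≫ b := by
  obtain ⟨b, hb⟩ := Triangle.yoneda_exact₃ _ (rot_of_distTriang _ hT) a ha
  exact ⟨-b, hb.trans ((Preadditive.neg_comp _ _).trans (Preadditive.comp_neg _ _).symm)⟩

end Triangles

variable {R : Type u} [CommRing R]

open Classical in
lemma exists_eq_sum_of_cofan {ι : Type u} {X : ι → ModuleCat.{u} R} {c : Cofan X}
    (hc : IsColimit c) (x : c.pt) :
    ∃ s : Finset ι, x = ∑ i ∈ s, c.inj i (cofanπ hc i x) := by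
  have key : ∀ x : c.pt, x ∈ ⨆ i, LinearMap.range (c.inj i).hom := by
    let N := ⨆ i, LinearMap.range (c.inj i).hom
    have h : ModuleCat.ofHom N.mkQ = 0 := by
      refine Cofan.IsColimit.hom_ext hc _ _ fun i => ?_
      ext y
      simp only [ModuleCat.hom_comp, ModuleCat.hom_ofHom, LinearMap.comp_apply, comp_zero,
        ModuleCat.hom_zero, LinearMap.zero_apply, Submodule.mkQ_apply]
      exact (Submodule.Quotient.mk_eq_zero _).2
        (Submodule.mem_iSup_of_mem i (LinearMap.mem_range_self _ _))
    intro x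
    have h2 : N.mkQ x = 0 := by
      have := congrArg (fun f => f.hom x) h
      simpa using this
    exact (Submodule.Quotient.mk_eq_zero _).1 h2
  obtain ⟨f, hf, hx⟩ := (Submodule.mem_iSup_iff_exists_finsupp _ _).1 (key x)
  choose y hy using hf
  refine ⟨f.support, ?_⟩
  have hπ : ∀ j, cofanπ hc j x = if j ∈ f.support then y j else 0 := by
    intro j
    rw [← hx, Finsupp.sum, map_sum]
    have h1 : ∀ i, cofanπ hc j (f i) = if i = j then y j else 0 := by
      intro i
      rw [← hy i]
      split_ifs with h
      · subst h
        exact ConcreteCategory.congr_hom (inj_cofanπ_self hc i) (y i)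
      · exact ConcreteCategory.congr_hom (inj_cofanπ_ne hc h) (y i)
    simp only [h1]
    simp
  conv_lhs => rw [← hx, Finsupp.sum]
  refine Finset.sum_congr rfl fun i hi => ?_
  rw [hπ, if_pos hi]
  exact (hy i).symm

/-! ### Homology of coproducts of complexes -/

section Complexes

variable {ι : Type u} {K K' : ι → CochainComplex (ModuleCat.{u} R) ℤ} {c : Cofan K} {c' : Cofan K'}

/-- The evaluation in a given degree of a coproduct of complexes. -/
def isColimitEvalCofan (hc : IsColimit c) (n : ℤ) :
    IsColimit (Cofan.mk (c.pt.X n) fun i => (c.inj i).f n) :=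
  isColimitCofanMkObjOfIsColimit (HomologicalComplex.eval _ _ n) _ _ 
    (IsColimit.ofIsoColimit hc (Cofan.ext (Iso.refl _)))

lemma cofanπ_eval (hc : IsColimit c) (n : ℤ) (i : ι) :
    cofanπ (isColimitEvalCofan hc n) i = (cofanπ hc i).f n := by
  refine Cofan.IsColimit.hom_ext (isColimitEvalCofan hc n) _ _ fun j => ?_
  have h : (c.inj j ≫ cofanπ hc i).f n = (c.inj j).f n ≫ (cofanπ hc i).f n := rfl
  by_cases hij : j = i
  · subst hij
    rw [inj_cofanπ_self]
    rw [inj_cofanπ_self] at h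
    exact h
  · rw [inj_cofanπ_ne _ hij]
    rw [inj_cofanπ_ne _ hij] at h
    exact h

/-- A cycle is the finite sum of its components, each of which is a cycle. This is the elementwise
form of the fact that homology commutes with coproducts. -/
lemma homology_exists_eq_sum (hc : IsColimit c) (n : ℤ) (x : c.pt.homology n) :
    ∃ s : Finset ι, x = ∑ i ∈ s, HomologicalComplex.homologyMap (c.inj i) n
      (HomologicalComplex.homologyMap (cofanπ hc i) n x) := by
  obtain ⟨z, rfl⟩ := (ModuleCat.epi_iff_surjective (c.pt.homologyπ n)).1 inferInstance x
  obtain ⟨s, hs⟩ := exists_eq_sum_of_cofan (isColimitEvalCofan hc n) (c.pt.iCycles n z)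
  refine ⟨s, ?_⟩
  have hz : z = ∑ i ∈ s, HomologicalComplex.cyclesMap (c.inj i) n
      (HomologicalComplex.cyclesMap (cofanπ hc i) n z) := by
    apply (ModuleCat.mono_iff_injective (c.pt.iCycles n)).1 inferInstance
    refine hs.trans ?_
    rw [map_sum]
    refine Finset.sum_congr rfl fun i _ => ?_
    rw [cofanπ_eval]
    have h1 := ConcreteCategory.congr_hom (HomologicalComplex.cyclesMap_i (c.inj i) n)
      (HomologicalComplex.cyclesMap (cofanπ hc i) n z)
    have h2 := ConcreteCategory.congr_hom (HomologicalComplex.cyclesMap_i (cofanπ hc i) n) z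
    simp only [ConcreteCategory.comp_apply] at h1 h2
    rw [h1, h2]
    rfl
  conv_lhs => rw [hz]
  rw [map_sum]
  refine Finset.sum_congr rfl fun i _ => ?_
  have h1 := ConcreteCategory.congr_hom (HomologicalComplex.homologyπ_naturality (c.inj i) n)
      (HomologicalComplex.cyclesMap (cofanπ hc i) n z)
  have h2 := ConcreteCategory.congr_hom
    (HomologicalComplex.homologyπ_naturality (cofanπ hc i) n) z
  simp only [ConcreteCategory.comp_apply] at h1 h2
  rw [h2, h1]

lemma homologyMap_cofan_hom_ext (hc : IsColimit c) (n : ℤ) {A : ModuleCat.{u} R}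
    {f g : c.pt.homology n ⟶ A}
    (h : ∀ i, HomologicalComplex.homologyMap (c.inj i) n ≫ f =
      HomologicalComplex.homologyMap (c.inj i) n ≫ g) : f = g := by
  ext x
  obtain ⟨s, hs⟩ := homology_exists_eq_sum hc n x
  rw [hs, map_sum, map_sum]
  exact Finset.sum_congr rfl fun i _ => ConcreteCategory.congr_hom (h i) _

/-- A coproduct of quasi-isomorphisms is a quasi-isomorphism. -/
lemma quasiIso_of_cofan (hc : IsColimit c) (hc' : IsColimit c') (s : ∀ i, K i ⟶ K' i)
    [∀ i, QuasiIso (s i)] (f : c.pt ⟶ c'.pt) (hf : ∀ i, c.inj i ≫ f = s i ≫ c'.inj i) :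
    QuasiIso f := by
  have hfπ : ∀ i, f ≫ cofanπ hc' i = cofanπ hc i ≫ s i := by
    intro i
    refine Cofan.IsColimit.hom_ext hc _ _ fun j => ?_
    rw [← Category.assoc, hf, Category.assoc, ← Category.assoc (c.inj j)]
    by_cases h : j = i
    · subst h
      simp
    · simp [inj_cofanπ_ne _ h]
  have inst : ∀ i n, IsIso (HomologicalComplex.homologyMap (s i) n) := fun i n => inferInstance
  refine (quasiIso_iff _).2 fun n => ?_
  rw [quasiIsoAt_iff_isIso_homologyMap]
  -- the homology of `f` has an explicit inverse on each element
  have hinj : Mono (HomologicalComplex.homologyMap f n) := by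
    rw [ModuleCat.mono_iff_injective, injective_iff_map_eq_zero]
    intro x hx
    obtain ⟨t, ht⟩ := homology_exists_eq_sum hc n x
    rw [ht]
    refine Finset.sum_eq_zero fun i _ => ?_
    suffices h : HomologicalComplex.homologyMap (cofanπ hc i) n x = 0 by rw [h, map_zero]
    apply (ModuleCat.mono_iff_injective _).1 (inferInstance :
      Mono (HomologicalComplex.homologyMap (s i) n))
    rw [map_zero, ← ConcreteCategory.comp_apply, ← HomologicalComplex.homologyMap_comp, ← hfπ,
      HomologicalComplex.homologyMap_comp, ConcreteCategory.comp_apply, hx, map_zero]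
  have hsurj : Epi (HomologicalComplex.homologyMap f n) := by
    refine ⟨fun {A} a b hab => homologyMap_cofan_hom_ext hc' n fun i => ?_⟩
    rw [← cancel_epi (HomologicalComplex.homologyMap (s i) n), ← Category.assoc, ← Category.assoc,
      ← HomologicalComplex.homologyMap_comp, ← hf, HomologicalComplex.homologyMap_comp,
      Category.assoc, Category.assoc, hab]
  exact isIso_of_mono_of_epi _

end Complexes

/-! ### Coproducts in the derived category -/

section DerivedCoproducts

open DerivedCategory

variable [HasDerivedCategory.{w} (ModuleCat.{u} R)]
  {ι : Type u} {K : ι → CochainComplex (ModuleCat.{u} R) ℤ} {c : Cofan K}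

lemma homologyFunctor_cofan_hom_ext (hc : IsColimit c) (n : ℤ) {A : ModuleCat.{u} R}
    {f g : (homologyFunctor _ n).obj (Q.obj c.pt) ⟶ A}
    (h : ∀ i, (homologyFunctor _ n).map (Q.map (c.inj i)) ≫ f =
      (homologyFunctor _ n).map (Q.map (c.inj i)) ≫ g) : f = g := by
  rw [← cancel_epi ((homologyFunctorFactors _ n).inv.app c.pt)]
  refine homologyMap_cofan_hom_ext hc n fun i => ?_
  have := (homologyFunctorFactors (ModuleCat.{u} R) n).inv.naturality (c.inj i)
  dsimp at this
  calc _ = ((HomologicalComplex.homologyFunctor _ _ n).map (c.inj i) ≫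
        (homologyFunctorFactors _ n).inv.app c.pt) ≫ f := (Category.assoc _ _ _).symm
    _ = ((HomologicalComplex.homologyFunctor _ _ n).map (c.inj i) ≫
        (homologyFunctorFactors _ n).inv.app c.pt) ≫ g := by
      rw [this, Category.assoc, Category.assoc, h i]
    _ = _ := Category.assoc _ _ _

/-- Calculus of fractions: each `f i` is a roof whose denominator `s i` is a quasi-isomorphism onto
`K i`, and the coproduct of the `s i` is again one. -/
lemma exists_desc_derived (hc : IsColimit c) {Y : DerivedCategory (ModuleCat.{u} R)}
    (f : ∀ i, Q.obj (K i) ⟶ Y) : ∃ g : Q.obj c.pt ⟶ Y, ∀ i, Q.map (c.inj i) ≫ g = f i := by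
  obtain ⟨Y, ⟨e⟩⟩ : ∃ Y', Nonempty (Q.obj Y' ≅ Y) := ⟨_, ⟨Q.objObjPreimageIso Y⟩⟩
  choose K' s hs g hg using fun i => right_fac (f i ≫ e.inv)
  have : ∀ i, QuasiIso (s i) := fun i => (isIso_Q_map_iff_quasiIso _ (s i)).1 (hs i)
  let c' : Cofan K' := Cofan.mk (∐ K') (Sigma.ι K')
  have hc' : IsColimit c' := coproductIsCoproduct K'
  let S : c'.pt ⟶ c.pt := Cofan.IsColimit.desc hc' fun i => s i ≫ c.inj i
  have hS : ∀ i, c'.inj i ≫ S = s i ≫ c.inj i := fun i => by simp [S]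
  have : QuasiIso S := quasiIso_of_cofan hc' hc s S hS
  let G : c'.pt ⟶ Y := Cofan.IsColimit.desc hc' g
  have hG : ∀ i, c'.inj i ≫ G = g i := fun i => by simp [G]
  refine ⟨inv (Q.map S) ≫ Q.map G ≫ e.hom, fun i => ?_⟩
  rw [← cancel_mono e.inv, hg i, ← cancel_epi (Q.map (s i))]
  simp only [Category.assoc, Iso.hom_inv_id, Category.comp_id, IsIso.hom_inv_id_assoc]
  rw [← Q.map_comp_assoc, ← hS, Q.map_comp_assoc, IsIso.hom_inv_id_assoc, ← Q.map_comp, hG]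

lemma derived_cofan_hom_ext (hc : IsColimit c) {Y : DerivedCategory (ModuleCat.{u} R)}
    (f : Q.obj c.pt ⟶ Y) (hf : ∀ i, Q.map (c.inj i) ≫ f = 0) : f = 0 := by
  obtain ⟨W, a, b, hT⟩ := distinguished_cocone_triangle₁ f
  choose t ht using fun i => exists_lift₁ hT (Q.map (c.inj i)) (hf i)
  obtain ⟨g, hg⟩ := exists_desc_derived hc t
  -- The lifts glue to `g`, and `g ≫ a` is the identity on homology. Being an isomorphism suffices,
  -- since `a ≫ f = 0`.
  have : IsIso (g ≫ a) := by
    rw [isIso_iff]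
    intro n
    have : (homologyFunctor _ n).map (g ≫ a) = 𝟙 _ := by
      refine homologyFunctor_cofan_hom_ext hc n fun i => ?_
      rw [← Functor.map_comp, ← Category.assoc, hg, Category.comp_id]
      exact congrArg _ (ht i).symm
    rw [this]
    infer_instance
  rw [← cancel_epi (g ≫ a), Category.assoc, comp_zero]
  rw [comp_eq_zero₁₂ hT, comp_zero]

/-- The localization functor to the derived category sends coproducts to coproducts. -/
def isColimitQCofan (hc : IsColimit c) :
    IsColimit (Cofan.mk (Q.obj c.pt) fun i => Q.map (c.inj i)) :=
  Cofan.IsColimit.mk _ (fun s => (exists_desc_derived hc s.inj).choose)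
    (fun s i => (exists_desc_derived hc s.inj).choose_spec i)
    (fun s m hm => by
      rw [← sub_eq_zero]
      refine derived_cofan_hom_ext hc _ fun i => ?_
      rw [Preadditive.comp_sub, (exists_desc_derived hc s.inj).choose_spec i, sub_eq_zero]
      exact hm i)

/-- The derived category has coproducts. -/
instance hasCoproductsOfShape_derived (ι : Type u) :
    HasColimitsOfShape (Discrete ι) (DerivedCategory (ModuleCat.{u} R)) := by
  have : ∀ X : ι → DerivedCategory (ModuleCat.{u} R), HasCoproduct X := fun X => by
    let K : ι → CochainComplex (ModuleCat.{u} R) ℤ := fun i => Q.objPreimage (X i)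
    have : HasCoproduct fun i => Q.obj (K i) := ⟨⟨_, isColimitQCofan (coproductIsCoproduct K)⟩⟩
    exact hasColimit_of_iso (Discrete.natIso fun i => (Q.objObjPreimageIso (X i.as)).symm :
      Discrete.functor X ≅ Discrete.functor fun i => Q.obj (K i))
  exact ⟨fun F => hasColimit_of_iso (Discrete.natIsoFunctor (F := F))⟩

instance preservesCoproducts_Q (ι : Type u) : PreservesColimitsOfShape (Discrete ι)
    (Q : CochainComplex (ModuleCat.{u} R) ℤ ⥤ DerivedCategory (ModuleCat.{u} R)) := by
  have : ∀ K : ι → CochainComplex (ModuleCat.{u} R) ℤ, PreservesColimit (Discrete.functor K) Q :=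
    fun K => preservesColimit_of_preserves_colimit_cocone (coproductIsCoproduct K)
      ((isColimitMapCoconeCofanMkEquiv _ _ _).symm (isColimitQCofan (coproductIsCoproduct K)))
  exact ⟨fun {F} => preservesColimit_of_iso_diagram Q (Discrete.natIsoFunctor (F := F)).symm⟩

lemma homologyFunctor_hom_ext {X : ι → DerivedCategory (ModuleCat.{u} R)} {c : Cofan X}
    (hc : IsColimit c) (n : ℤ) {A : ModuleCat.{u} R} {f g : (homologyFunctor _ n).obj c.pt ⟶ A}
    (h : ∀ i, (homologyFunctor _ n).map (c.inj i) ≫ f = (homologyFunctor _ n).map (c.inj i) ≫ g) :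
    f = g := by
  let K : ι → CochainComplex (ModuleCat.{u} R) ℤ := fun i => Q.objPreimage (X i)
  let e : ∀ i, Q.obj (K i) ≅ X i := fun i => Q.objObjPreimageIso (X i)
  have hK := isColimitQCofan (coproductIsCoproduct K)
  let p : Q.obj (∐ K) ⟶ c.pt := Cofan.IsColimit.desc hK fun i => (e i).hom ≫ c.inj i
  let q : c.pt ⟶ Q.obj (∐ K) := Cofan.IsColimit.desc hc fun i => (e i).inv ≫ Q.map (Sigma.ι K i)
  have hp : ∀ i, Q.map (Sigma.ι K i) ≫ p = (e i).hom ≫ c.inj i :=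
    fun i => Cofan.IsColimit.fac hK _ i
  have hqp : q ≫ p = 𝟙 _ := by
    refine Cofan.IsColimit.hom_ext hc _ _ fun i => ?_
    rw [← Category.assoc]
    simp only [q, Cofan.IsColimit.fac, Category.assoc, hp, Iso.inv_hom_id_assoc, Category.comp_id]
  have : Epi ((homologyFunctor _ n).map p) := by
    have : IsSplitEpi p := ⟨⟨⟨q, hqp⟩⟩⟩
    infer_instance
  rw [← cancel_epi ((homologyFunctor _ n).map p)]
  refine homologyFunctor_cofan_hom_ext (coproductIsCoproduct K) n fun i => ?_
  have h2 : Q.map ((Cofan.mk (∐ K) (Sigma.ι K)).inj i) ≫ p = (e i).hom ≫ c.inj i := hp i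
  rw [← Functor.map_comp_assoc, ← Functor.map_comp_assoc, h2, Functor.map_comp, Category.assoc,
    Category.assoc, h i]

end DerivedCoproducts

end PureDerived

end

noncomputable section

namespace PureDerived

/-! ### Cones of coproducts and of composites -/

section Triangulated

variable {C : Type*} [Category* C] [HasZeroObject C] [HasShift C ℤ] [Preadditive C]
  [∀ n : ℤ, (shiftFunctor C n).Additive] [Pretriangulated C]

/-- The shift of a coproduct. -/
def isColimitShiftCofan {ι : Type*} {X : ι → C} {c : Cofan X} (hc : IsColimit c) :
    IsColimit (Cofan.mk (c.pt⟦(1 : ℤ)⟧) fun i => (c.inj i)⟦(1 : ℤ)⟧') :=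
  isColimitCofanMkObjOfIsColimit (shiftFunctor C (1 : ℤ)) _ _
    (IsColimit.ofIsoColimit hc (Cofan.ext (Iso.refl _)))

/-- The cone of a coproduct of morphisms is the coproduct of the cones. -/
lemma trW_of_cofan {P : ObjectProperty C} [P.IsClosedUnderIsomorphisms] {ι : Type*}
    {X Y Z : ι → C} {f : ∀ i, X i ⟶ Y i} {g : ∀ i, Y i ⟶ Z i} {h : ∀ i, Z i ⟶ (X i)⟦(1 : ℤ)⟧}
    (hT : ∀ i, Triangle.mk (f i) (g i) (h i) ∈ distTriang C)
    {cX : Cofan X} {cY : Cofan Y} {cZ : Cofan Z} (hX : IsColimit cX) (hY : IsColimit cY)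
    (hZ : IsColimit cZ) (hP : P cZ.pt) (F : cX.pt ⟶ cY.pt)
    (hF : ∀ i, cX.inj i ≫ F = f i ≫ cY.inj i) : P.trW F := by
  obtain ⟨W, G, H, hW⟩ := distinguished_cocone_triangle F
  have hψ : ∀ i, ∃ ψ : Z i ⟶ W, g i ≫ ψ = cY.inj i ≫ G ∧
      h i ≫ (cX.inj i)⟦(1 : ℤ)⟧' = ψ ≫ H := fun i =>
    complete_distinguished_triangle_morphism _ _ (hT i) hW (cX.inj i) (cY.inj i) (hF i).symm
  choose ψ hψ₁ hψ₂ using hψ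
  let Ψ : cZ.pt ⟶ W := Cofan.IsColimit.desc hZ ψ
  have hΨ : ∀ i, cZ.inj i ≫ Ψ = ψ i := fun i => Cofan.IsColimit.fac hZ ψ i
  have hX1 := isColimitShiftCofan hX
  have hY1 := isColimitShiftCofan hY
  have hepi : Epi Ψ := by
    refine Preadditive.epi_of_cancel_zero _ fun {A} a ha => ?_
    have ha' : ∀ i, ψ i ≫ a = 0 := fun i => by rw [← hΨ, Category.assoc, ha, comp_zero]
    have h1 : G ≫ a = 0 := by
      refine Cofan.IsColimit.hom_ext hY _ _ fun i => ?_
      rw [← Category.assoc, ← hψ₁, Category.assoc, ha', comp_zero, comp_zero]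
    obtain ⟨k, rfl⟩ := exists_desc₁ hW a h1
    have h2 : ∀ i, ∃ l : (Y i)⟦(1 : ℤ)⟧ ⟶ A, (cX.inj i)⟦(1 : ℤ)⟧' ≫ k = (f i)⟦(1 : ℤ)⟧' ≫ l := by
      refine fun i => exists_desc_shift (hT i) _ ?_
      rw [← Category.assoc, hψ₂, Category.assoc, ha']
    choose l hl using h2
    let L : cY.pt⟦(1 : ℤ)⟧ ⟶ A := Cofan.IsColimit.desc hY1 l
    have hL : ∀ i, (cY.inj i)⟦(1 : ℤ)⟧' ≫ L = l i := fun i => Cofan.IsColimit.fac hY1 l i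
    have hk : k = F⟦(1 : ℤ)⟧' ≫ L := by
      refine Cofan.IsColimit.hom_ext hX1 _ _ fun i => ?_
      refine (hl i).trans ?_
      rw [← hL, ← Category.assoc, ← Functor.map_comp, ← hF, Functor.map_comp, Category.assoc]
      rfl
    rw [hk, ← Category.assoc, comp_eq_zero₃₁ hW, zero_comp]
  -- A first extension `r` retracts `Ψ` only up to errors `h i ≫ k i`; these glue to `Ψ ≫ H ≫ K`, so
  -- `r - H ≫ K` is a retraction.
  have hsplit : ∃ r : W ⟶ cZ.pt, Ψ ≫ r = 𝟙 _ := by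
    have h1 : F ≫ Cofan.IsColimit.desc hY (fun i => g i ≫ cZ.inj i) = 0 := by
      refine Cofan.IsColimit.hom_ext hX _ _ fun i => ?_
      rw [← Category.assoc, hF, Category.assoc, Cofan.IsColimit.fac, ← Category.assoc,
        comp_eq_zero₁₂ (hT i), zero_comp, comp_zero]
    obtain ⟨r, hr⟩ := exists_desc₃ hW _ h1
    have h2 : ∀ i, ∃ k : (X i)⟦(1 : ℤ)⟧ ⟶ cZ.pt, ψ i ≫ r - cZ.inj i = h i ≫ k := fun i => by
      refine exists_desc₁ (hT i) _ ?_
      rw [Preadditive.comp_sub, ← Category.assoc, hψ₁, Category.assoc, ← hr,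
        Cofan.IsColimit.fac, sub_self]
    choose k hk using h2
    let K : cX.pt⟦(1 : ℤ)⟧ ⟶ cZ.pt := Cofan.IsColimit.desc hX1 k
    have hK : ∀ i, (cX.inj i)⟦(1 : ℤ)⟧' ≫ K = k i := fun i => Cofan.IsColimit.fac hX1 k i
    refine ⟨r - H ≫ K, Cofan.IsColimit.hom_ext hZ _ _ fun i => ?_⟩
    rw [Preadditive.comp_sub, Preadditive.comp_sub, ← Category.assoc, hΨ, ← Category.assoc Ψ,
      ← Category.assoc, ← Category.assoc, hΨ, ← hψ₂, Category.assoc, hK, ← hk, Category.comp_id]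
    abel
  obtain ⟨r, hr⟩ := hsplit
  have : IsIso Ψ := ⟨r, hr, by rw [← cancel_epi Ψ, ← Category.assoc, hr]; simp⟩
  exact ⟨W, G, H, hW, P.prop_of_iso (asIso Ψ) hP⟩

/-- By the octahedral axiom the cones of `f`, `f ≫ g` and `g` form a triangle. -/
lemma trW_of_comp [IsTriangulated C] {P : ObjectProperty C} [P.IsTriangulated]
    [P.IsClosedUnderIsomorphisms] {X Y Z : C} (f : X ⟶ Y) (g : Y ⟶ Z) (hfg : P.trW (f ≫ g))
    (hg : P.trW g) : P.trW f := by
  obtain ⟨A, a, a', hA⟩ := distinguished_cocone_triangle f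
  obtain ⟨B, b, b', hB, hPB⟩ := hg
  obtain ⟨D, d, d', hD, hPD⟩ := hfg
  exact ⟨A, a, a', hA, P.ext_of_isTriangulatedClosed₁ _
    (Triangulated.someOctahedron rfl hA hB hD).mem hPD hPB⟩

end Triangulated

/-! ### Mapping telescopes -/

section Telescope

variable {C : Type*} [Category* C] {X : ℕ → C}
  {c : Cofan fun i : ULift.{u} ℕ => X i.down}

/-- The shift map of the telescope of a sequence of morphisms. -/
def telescopeShift (f : ∀ n, X n ⟶ X (n + 1)) (hc : IsColimit c) : c.pt ⟶ c.pt :=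
  Cofan.IsColimit.desc hc fun i => f i.down ≫ c.inj ⟨i.down + 1⟩

lemma inj_telescopeShift (f : ∀ n, X n ⟶ X (n + 1)) (hc : IsColimit c) (n : ℕ) :
    c.inj ⟨n⟩ ≫ telescopeShift f hc = f n ≫ c.inj ⟨n + 1⟩ :=
  Cofan.IsColimit.fac hc _ _

variable [Preadditive C]

lemma telescopeShift_π_zero (f : ∀ n, X n ⟶ X (n + 1)) (hc : IsColimit c) :
    telescopeShift f hc ≫ cofanπ hc ⟨0⟩ = 0 := by
  refine Cofan.IsColimit.hom_ext hc _ _ fun ⟨n⟩ => ?_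
  rw [← Category.assoc, inj_telescopeShift, Category.assoc, inj_cofanπ_ne hc (by simp), comp_zero,
    comp_zero]

lemma telescopeShift_π_succ (f : ∀ n, X n ⟶ X (n + 1)) (hc : IsColimit c) (n : ℕ) :
    telescopeShift f hc ≫ cofanπ hc ⟨n + 1⟩ = cofanπ hc ⟨n⟩ ≫ f n := by
  refine Cofan.IsColimit.hom_ext hc _ _ fun ⟨m⟩ => ?_
  rw [← Category.assoc, inj_telescopeShift, Category.assoc,
    ← Category.assoc (c.inj ⟨m⟩)]
  by_cases h : m = n
  · subst h
    rw [inj_cofanπ_self, inj_cofanπ_self, Category.comp_id, Category.id_comp]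
  · rw [inj_cofanπ_ne hc (i := ⟨m⟩) (by simpa using h),
      inj_cofanπ_ne hc (i := ⟨m + 1⟩) (by simpa using h), comp_zero, zero_comp]

end Telescope

/-! ### Ghosts and compact objects -/

section Ghost

open DerivedCategory

variable {R : Type u} [CommRing R] [HasDerivedCategory.{w} (ModuleCat.{u} R)]

/-- A morphism in the derived category is a ghost if it is zero in homology. -/
def IsGhost {X Y : DerivedCategory (ModuleCat.{u} R)} (f : X ⟶ Y) : Prop :=
  ∀ n : ℤ, (homologyFunctor _ n).map f = 0

variable {X : ℕ → DerivedCategory (ModuleCat.{u} R)} {f : ∀ n, X n ⟶ X (n + 1)}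
  {c : Cofan fun i : ULift.{u} ℕ => X i.down}

/-- The homotopy colimit of a sequence of ghosts vanishes. -/
lemma isIso_id_sub_telescopeShift (hf : ∀ n, IsGhost (f n)) (hc : IsColimit c) :
    IsIso (𝟙 c.pt - telescopeShift f hc) := by
  rw [isIso_iff]
  intro n
  have h0 : (homologyFunctor _ n).map (telescopeShift f hc) = 0 := by
    refine homologyFunctor_hom_ext hc n fun ⟨i⟩ => ?_
    rw [← Functor.map_comp, inj_telescopeShift, Functor.map_comp, hf, zero_comp, comp_zero]
  rw [Functor.map_sub, h0, sub_zero, CategoryTheory.Functor.map_id]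
  infer_instance

variable {A : DerivedCategory (ModuleCat.{u} R)} (hA : IsCompactObject A)

include hA

open Classical in
lemma IsCompactObject.exists_eq_sum {ι : Type u} {X : ι → DerivedCategory (ModuleCat.{u} R)}
    {c : Cofan X} (hc : IsColimit c) (y : A ⟶ c.pt) :
    ∃ s : Finset ι, y = ∑ i ∈ s, (y ≫ cofanπ hc i) ≫ c.inj i := by
  obtain ⟨d, rfl⟩ := (hA ι X c hc).2 y
  have hd : (DirectSum.toAddMonoid (fun i => Preadditive.rightComp A (c.inj i))) d =
      ∑ i ∈ DFinsupp.support d, d i ≫ c.inj i := by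
    refine (DFinsupp.sumAddHom_apply _ _).trans ?_
    rfl
  refine ⟨DFinsupp.support d, ?_⟩
  have hπ : ∀ j, (∑ i ∈ DFinsupp.support d, d i ≫ c.inj i) ≫ cofanπ hc j = d j := by
    intro j
    rw [Preadditive.sum_comp]
    by_cases hj : j ∈ DFinsupp.support d
    · rw [Finset.sum_eq_single_of_mem j hj fun i _ hij => by
        rw [Category.assoc, inj_cofanπ_ne hc hij, comp_zero]]
      simp
    · rw [DFinsupp.notMem_support_iff.1 hj]
      refine Finset.sum_eq_zero fun i hi => ?_
      rw [Category.assoc, inj_cofanπ_ne hc (by rintro rfl; exact hj hi), comp_zero]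
  simp only [hd, hπ]

/-- A morphism from a compact object to the start of a sequence of ghosts dies at a finite stage. -/
lemma IsCompactObject.exists_eq_zero_of_isGhost (hf : ∀ n, IsGhost (f n)) (x : ∀ n, A ⟶ X n)
    (hx : ∀ n, x (n + 1) = x n ≫ f n) : ∃ n, x n = 0 := by
  let c := colimit.cocone (Discrete.functor fun i : ULift.{u} ℕ => X i.down)
  have hc : IsColimit (C := DerivedCategory (ModuleCat.{u} R)) c := colimit.isColimit _
  let c' : Cofan (fun i : ULift.{u} ℕ => X i.down) := c
  have hc' : IsColimit c' := hc
  have := isIso_id_sub_telescopeShift hf hc'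
  -- The formal solution is the geometric series, whose `n`-th component is `x n`. Compactness of
  -- `A` allows only finitely many nonzero components.
  let y : A ⟶ c'.pt := (x 0 ≫ c'.inj ⟨0⟩) ≫ inv (𝟙 c'.pt - telescopeShift f hc')
  have hy : y - y ≫ telescopeShift f hc' = x 0 ≫ c'.inj ⟨0⟩ := by
    have : y ≫ (𝟙 c'.pt - telescopeShift f hc') = x 0 ≫ c'.inj ⟨0⟩ := by
      rw [Category.assoc, IsIso.inv_hom_id, Category.comp_id]
    rwa [Preadditive.comp_sub, Category.comp_id] at this
  have hyπ : ∀ n, y ≫ cofanπ hc' ⟨n⟩ = x n := by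
    intro n
    induction n with
    | zero =>
      have := congrArg (· ≫ cofanπ hc' ⟨0⟩) hy
      simpa only [Preadditive.sub_comp, Category.assoc, telescopeShift_π_zero, comp_zero, sub_zero,
        inj_cofanπ_self, Category.comp_id] using this
    | succ n ih =>
      have := congrArg (· ≫ cofanπ hc' ⟨n + 1⟩) hy
      simp only [Preadditive.sub_comp, Category.assoc, telescopeShift_π_succ] at this
      rw [inj_cofanπ_ne hc' (by simp), comp_zero, sub_eq_zero] at this
      rw [this, ← Category.assoc, ih, hx]
  obtain ⟨s, hs⟩ := hA.exists_eq_sum hc' y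
  obtain ⟨⟨n⟩, hn⟩ := Infinite.exists_notMem_finset s
  refine ⟨n, ?_⟩
  rw [← hyπ n, hs, Preadditive.sum_comp]
  refine Finset.sum_eq_zero fun i hi => ?_
  rw [Category.assoc, inj_cofanπ_ne hc' (by rintro rfl; exact hn hi), comp_zero]

end Ghost

/-! ### Retracts and generation in localizing subcategories -/

section Localizing

open DerivedCategory

variable {R : Type u} [CommRing R] [HasDerivedCategory.{w} (ModuleCat.{u} R)]
  {P : ObjectProperty (DerivedCategory (ModuleCat.{u} R))} (hP : IsLocalizing P)

include hP

lemma IsLocalizing.prop_cofan {ι : Type u} {X : ι → DerivedCategory (ModuleCat.{u} R)}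
    {c : Cofan X} (hc : IsColimit c) (hX : ∀ i, P (X i)) : P c.pt :=
  have := hP.coproducts ι
  P.prop_of_isColimit hc fun ⟨i⟩ => hX i

lemma IsLocalizing.prop₃ {X Y Z : DerivedCategory (ModuleCat.{u} R)} {f : X ⟶ Y} {g : Y ⟶ Z}
    {h : Z ⟶ X⟦(1 : ℤ)⟧} (hT : Triangle.mk f g h ∈ distTriang _) (hX : P X) (hY : P Y) : P Z :=
  have := hP.isTriangulated
  have := hP.isClosedUnderIsomorphisms
  P.ext_of_isTriangulatedClosed₃ _ hT hX hY

/-- Localizing subcategories are closed under retracts. -/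
lemma IsLocalizing.prop_of_retract {E Y : DerivedCategory (ModuleCat.{u} R)} (i : E ⟶ Y)
    (r : Y ⟶ E) (hir : i ≫ r = 𝟙 E) (hY : P Y) : P E := by
  let X : ℕ → DerivedCategory (ModuleCat.{u} R) := fun _ => Y
  let c : Cofan (fun k : ULift.{u} ℕ => X k.down) :=
    colimit.cocone (Discrete.functor fun k : ULift.{u} ℕ => X k.down)
  have hc : IsColimit c := colimit.isColimit _
  -- The telescope of the idempotent `e` is a cone of objects of `P`; it is shown to be `E`.
  let e : Y ⟶ Y := r ≫ i
  have hee : e ≫ e = e := by simp only [e, Category.assoc, reassoc_of% hir]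
  let ι : ℕ → (Y ⟶ c.pt) := fun n => c.inj ⟨n⟩
  let φ : c.pt ⟶ c.pt := 𝟙 _ - telescopeShift (X := X) (fun _ => e) hc
  have hφ : ∀ n, ι n ≫ φ = ι n - e ≫ ι (n + 1) := fun n => by
    simp only [φ, Preadditive.comp_sub, Category.comp_id]
    rw [inj_telescopeShift (X := X) (fun _ => e) hc n]
  -- On the `1 - e` part `φ` is the identity; on the `e` part it sends `ι n` to `ι n - ι (n + 1)`,
  -- with retraction `ι n ↦ -∑_{j < n} ι j`. The formula adds the two retractions.
  let ψ : c.pt ⟶ c.pt := Cofan.IsColimit.desc hc fun k =>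
    ι k.down - e ≫ ι k.down - e ≫ ∑ j ∈ Finset.range k.down, ι j
  have hψ : ∀ n, ι n ≫ ψ = ι n - e ≫ ι n - e ≫ ∑ j ∈ Finset.range n, ι j :=
    fun n => Cofan.IsColimit.fac hc _ _
  have hφψ : φ ≫ ψ = 𝟙 _ := by
    refine Cofan.IsColimit.hom_ext hc _ _ fun ⟨n⟩ => ?_
    change ι n ≫ φ ≫ ψ = ι n ≫ 𝟙 _
    rw [← Category.assoc, hφ, Preadditive.sub_comp, Category.assoc, hψ, hψ, Finset.sum_range_succ]
    simp only [Preadditive.comp_sub, Preadditive.comp_add, Category.comp_id]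
    simp only [← Category.assoc, hee]
    abel
  obtain ⟨Z, b, d, hT⟩ := distinguished_cocone_triangle φ
  have hb : Epi b := by
    have : Mono φ := (SplitMono.mk ψ hφψ).mono
    exact Triangle.epi₂ _ hT (Triangle.mor₃_eq_zero_of_mono₁ _ hT this)
  have hbι : ∀ n, ι n ≫ b = e ≫ ι (n + 1) ≫ b := fun n => by
    have h := congrArg (ι n ≫ ·) (comp_eq_zero₁₂ hT)
    simp only [← Category.assoc, hφ, Preadditive.sub_comp, comp_zero, sub_eq_zero] at h
    simpa using h
  have hbe : ∀ n, ι n ≫ b = e ≫ ι n ≫ b := fun n => by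
    rw [hbι, ← Category.assoc e e, hee]
  have hb0 : ∀ n, ι n ≫ b = e ≫ ι 0 ≫ b := fun n => by
    induction n with
    | zero => exact hbe 0
    | succ n ih => rw [← ih, hbι n, ← hbe]
  obtain ⟨h, hh⟩ := exists_desc₃ hT (Cofan.IsColimit.desc hc fun _ => r) (by
    refine Cofan.IsColimit.hom_ext hc _ _ fun ⟨n⟩ => ?_
    have hr : ∀ n, ι n ≫ Cofan.IsColimit.desc hc (fun _ => r) = r :=
      fun n => Cofan.IsColimit.fac hc _ _
    change ι n ≫ φ ≫ _ = ι n ≫ 0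
    rw [← Category.assoc, hφ, Preadditive.sub_comp, Category.assoc, hr, hr, comp_zero]
    simp [e, hir])
  have hr : ∀ n, ι n ≫ b ≫ h = r := fun n => by
    rw [← hh]
    exact Cofan.IsColimit.fac hc _ _
  have hE : (i ≫ ι 0 ≫ b) ≫ h = 𝟙 E := by simp only [Category.assoc, hr, hir]
  have hZ : h ≫ i ≫ ι 0 ≫ b = 𝟙 Z := by
    rw [← cancel_epi b]
    refine Cofan.IsColimit.hom_ext hc _ _ fun ⟨n⟩ => ?_
    change ι n ≫ b ≫ h ≫ _ = ι n ≫ b ≫ 𝟙 Z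
    rw [Category.comp_id, hb0 n, ← Category.assoc b, ← Category.assoc (ι n), hr]
    simp [e]
  have := hP.isClosedUnderIsomorphisms
  have hYc : P c.pt := hP.prop_cofan hc fun _ => hY
  exact P.prop_of_iso (⟨h, i ≫ ι 0 ≫ b, hZ, hE⟩ : Z ≅ E) (hP.prop₃ hT hYc hYc)

/-- If every object receives a morphism from an object of a localizing subcategory `P` that is
surjective in homology, then `P` contains every object. -/
lemma IsLocalizing.prop_of_approximation
    (h : ∀ X : DerivedCategory (ModuleCat.{u} R), ∃ (A : DerivedCategory (ModuleCat.{u} R))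
      (f : A ⟶ X), P A ∧ ∀ n, Epi ((homologyFunctor _ n).map f))
    (X : DerivedCategory (ModuleCat.{u} R)) : P X := by
  have := hP.isTriangulated
  have := hP.isClosedUnderIsomorphisms
  have h' : ∀ X : DerivedCategory (ModuleCat.{u} R), ∃ (Y : DerivedCategory (ModuleCat.{u} R))
      (g : X ⟶ Y), IsGhost g ∧ P.trW g := by
    intro X
    obtain ⟨A, f, hA, hf⟩ := h X
    obtain ⟨Y, g, δ, hT⟩ := distinguished_cocone_triangle f
    exact ⟨Y, g, fun n => (HomologySequence.epi_homologyMap_mor₁_iff _ hT n).1 (hf n),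
      ObjectProperty.trW.mk' P hT hA⟩
  choose S g hg hgP using h'
  -- A tower of ghosts under `X` whose steps have cone in `P`. Its telescope vanishes, so comparison
  -- with the constant tower puts the telescope of the latter in `P`.
  let T : ℕ → DerivedCategory (ModuleCat.{u} R) := fun n => Nat.rec X (fun _ Y => S Y) n
  let f : ∀ n, T n ⟶ T (n + 1) := fun n => g (T n)
  let v : ∀ n, X ⟶ T n := fun n => Nat.rec (𝟙 X) (fun n y => y ≫ f n) n
  have hv : ∀ n, v (n + 1) = v n ≫ f n := fun n => rfl
  have hvP : ∀ n, P.trW (v n) := fun n => by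
    induction n with
    | zero => exact MorphismProperty.id_mem P.trW X
    | succ n ih => exact P.trW.comp_mem _ _ ih (hgP (T n))
  let X' : ℕ → DerivedCategory (ModuleCat.{u} R) := fun _ => X
  let c : Cofan (fun k : ULift.{u} ℕ => X' k.down) :=
    colimit.cocone (Discrete.functor fun k : ULift.{u} ℕ => X' k.down)
  have hc : IsColimit c := colimit.isColimit _
  let d : Cofan (fun k : ULift.{u} ℕ => T k.down) :=
    colimit.cocone (Discrete.functor fun k : ULift.{u} ℕ => T k.down)
  have hd : IsColimit d := colimit.isColimit _
  let V : c.pt ⟶ d.pt := Cofan.IsColimit.desc hc fun k => v k.down ≫ d.inj k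
  have hV : ∀ k, c.inj k ≫ V = v k.down ≫ d.inj k := fun k => Cofan.IsColimit.fac hc _ _
  have hVP : P.trW V := by
    choose W a b hT hW using hvP
    exact trW_of_cofan (fun k : ULift.{u} ℕ => hT k.down) hc hd
      (coproductIsCoproduct fun k : ULift.{u} ℕ => W k.down)
      (hP.prop_cofan (coproductIsCoproduct fun k : ULift.{u} ℕ => W k.down) fun k => hW k.down)
      V hV
  let φ : c.pt ⟶ c.pt := 𝟙 _ - telescopeShift (X := X') (fun _ => 𝟙 X) hc
  have hcomm : φ ≫ V = V ≫ (𝟙 d.pt - telescopeShift f hd) := by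
    refine Cofan.IsColimit.hom_ext hc _ _ fun ⟨n⟩ => ?_
    simp only [φ, Preadditive.sub_comp, Preadditive.comp_sub, Category.id_comp, Category.comp_id]
    rw [← Category.assoc, ← Category.assoc, inj_telescopeShift (X := X') (fun _ => 𝟙 X) hc n,
      hV, Category.assoc (v _), inj_telescopeShift f hd n, Category.assoc, hV, Category.id_comp,
      ← Category.assoc, hv]
  have hφP : P.trW φ := by
    have := isIso_id_sub_telescopeShift (fun n => hg (T n)) hd
    have h1 : P.trW (V ≫ (𝟙 d.pt - telescopeShift f hd)) :=
      P.trW.comp_mem _ _ hVP (P.trW_of_isIso _)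
    rw [← hcomm] at h1
    exact trW_of_comp _ _ h1 hVP
  obtain ⟨Z, b, δ, hT, hZ⟩ := hφP
  -- `Z` is the telescope of the constant tower; it is enough that `X` is a retract of it.
  obtain ⟨p, hp⟩ := exists_desc₃ hT (Cofan.IsColimit.desc hc fun _ => 𝟙 X) (by
    refine Cofan.IsColimit.hom_ext hc _ _ fun ⟨n⟩ => ?_
    simp only [φ, Preadditive.sub_comp, Preadditive.comp_sub, Category.id_comp, comp_zero]
    rw [← Category.assoc, inj_telescopeShift (X := X') (fun _ => 𝟙 X) hc n, Category.assoc,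
      Cofan.IsColimit.fac, Cofan.IsColimit.fac]
    simp [X'])
  refine hP.prop_of_retract (c.inj ⟨0⟩ ≫ b) p ?_ hZ
  rw [Category.assoc, ← hp, Cofan.IsColimit.fac]

end Localizing

end PureDerived

end

noncomputable section

namespace PureDerived

/-! ### Flat modules and purity -/

section Algebra

variable {R : Type*} [CommRing R]

/-- A submodule of a free module with flat quotient is pure: every finite subset of it is fixed by
a linear retraction onto the submodule. -/
lemma exists_linearMap_fixing_finset {ι M K : Type*} [AddCommGroup M] [Module R M] [AddCommGroup K]
    [Module R K] [Module.Flat R M] (i : K →ₗ[R] (ι →₀ R)) (p : (ι →₀ R) →ₗ[R] M)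
    (hi : Function.Injective i) (hp : Function.Surjective p) (h : Function.Exact i p)
    (t : Finset K) : ∃ r : (ι →₀ R) →ₗ[R] K, ∀ k ∈ t, r (i k) = k := by
  classical
  let s : Finset ι := t.biUnion fun k => (i k).support
  let j : (s →₀ R) →ₗ[R] (ι →₀ R) := Finsupp.lmapDomain R R Subtype.val
  let q : (ι →₀ R) →ₗ[R] (s →₀ R) := Finsupp.lcomapDomain Subtype.val Subtype.val_injective
  have hq : ∀ k ∈ t, j (q (i k)) = i k := by
    intro k hk
    refine Finsupp.mapDomain_comapDomain _ Subtype.val_injective _ ?_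
    intro a ha
    exact ⟨⟨a, Finset.mem_biUnion.2 ⟨k, hk, ha⟩⟩, rfl⟩
  let F : (t →₀ R) →ₗ[R] (s →₀ R) :=
    Finsupp.linearCombination R fun k : t => q (i k)
  -- Equational criterion of flatness: `p ∘ₗ j` factors through a finite free module by a map `a`
  -- killing the given elements. Subtracting a lift `l ∘ₗ a` then moves the image into `ker p` and
  -- leaves those elements fixed.
  obtain ⟨n, a, y, hya, haf⟩ := Module.Flat.exists_factorization_of_comp_eq_zero_of_free
    (f := F) (x := p ∘ₗ j) (by
      ext k
      simp only [F, LinearMap.comp_apply, Finsupp.lsingle_apply, Finsupp.linearCombination_single,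
        one_smul, hq k k.2, h.apply_apply_eq_zero, LinearMap.zero_apply])
  obtain ⟨l, hl⟩ := Module.projective_lifting_property p y hp
  let e : (ι →₀ R) →ₗ[R] (ι →₀ R) := (j - l ∘ₗ a) ∘ₗ q
  have hpe : ∀ x, p (e x) = 0 := by
    intro x
    have h1 : p (j (q x)) = y (a (q x)) := LinearMap.congr_fun hya (q x)
    have h2 : p (l (a (q x))) = y (a (q x)) := LinearMap.congr_fun hl (a (q x))
    simp only [e, LinearMap.comp_apply, LinearMap.sub_apply, map_sub, h1, h2, sub_self]
  let E := LinearEquiv.ofInjective i hi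
  have hmem : ∀ x, e x ∈ LinearMap.range i := fun x => (h (e x)).1 (hpe x)
  refine ⟨E.symm.toLinearMap ∘ₗ e.codRestrict _ hmem, fun k hk => ?_⟩
  have h3 : a (q (i k)) = 0 := by
    have := LinearMap.congr_fun haf (Finsupp.single ⟨k, hk⟩ 1)
    simpa [F] using this
  have h4 : e (i k) = i k := by
    simp only [e, LinearMap.comp_apply, LinearMap.sub_apply, h3, map_zero, sub_zero, hq k hk]
  apply E.injective
  simp only [LinearMap.comp_apply, LinearEquiv.coe_coe, LinearEquiv.apply_symm_apply]
  ext1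
  exact h4

/-- Flatness of `P` keeps `g` injective after tensoring, so injectivity of `φ ⊗ K` is inherited from
`φ ⊗ N`. -/
lemma flat_of_exact {K N P : Type*} [AddCommGroup K] [Module R K] [AddCommGroup N] [Module R N]
    [AddCommGroup P] [Module R P] [Module.Flat R N] [Module.Flat R P] (g : K →ₗ[R] N)
    (f : N →ₗ[R] P) (hg : Function.Injective g) (hf : Function.Surjective f)
    (h : Function.Exact g f) : Module.Flat R K := by
  rw [Module.Flat.iff_rTensor_preserves_injective_linearMap]
  intro A B _ _ _ _ φ hφ
  have h1 : Function.Injective (φ.rTensor N ∘ₗ g.lTensor A) :=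
    (Module.Flat.rTensor_preserves_injective_linearMap φ hφ).comp
      (LinearMap.lTensor_injective_of_exact_of_flat f hf g hg h A)
  have h2 : φ.rTensor N ∘ₗ g.lTensor A = g.lTensor B ∘ₗ φ.rTensor K := by
    rw [LinearMap.rTensor_comp_lTensor, LinearMap.lTensor_comp_rTensor]
  rw [h2] at h1
  exact Function.Injective.of_comp h1

open TensorProduct in
/-- The cokernel of a faithfully flat ring homomorphism is flat. -/
lemma flat_quotient_of_faithfullyFlat (S : Type*) [CommRing S] [Algebra R S]
    [Module.FaithfullyFlat R S] :
    Module.Flat R (S ⧸ LinearMap.range (Algebra.linearMap R S)) := by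
  let N := LinearMap.range (Algebra.linearMap R S)
  let m : S ⊗[R] S →ₗ[S] S ⊗[R] (S ⧸ N) := N.mkQ.baseChange S
  -- The map `b ↦ 1 ⊗ b - b ⊗ 1` kills the image of `R`; its `S`-linear extension `σ` splits the
  -- base-changed quotient map `m`.
  let d : S →ₗ[R] S ⊗[R] S :=
    TensorProduct.mk R S S 1 - (TensorProduct.mk R S S).flip 1
  let d' : S ⧸ N →ₗ[R] S ⊗[R] S := N.liftQ d (by
    rintro _ ⟨r, rfl⟩
    simp [d, Algebra.algebraMap_eq_smul_one])
  let σ : S ⊗[R] (S ⧸ N) →ₗ[S] S ⊗[R] S := TensorProduct.AlgebraTensorModule.lift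
    ((LinearMap.toSpanSingleton S (S ⧸ N →ₗ[R] S ⊗[R] S) d'))
  have hσ : m ∘ₗ σ = LinearMap.id := by
    refine LinearMap.ext fun x => ?_
    induction x with
    | zero => simp
    | add x y hx hy => rw [map_add, hx, hy, map_add]
    | tmul a q =>
      obtain ⟨b, rfl⟩ := N.mkQ_surjective q
      have h1 : N.mkQ 1 = 0 := (Submodule.Quotient.mk_eq_zero N).2 ⟨1, by simp⟩
      have h2 : σ (a ⊗ₜ[R] N.mkQ b) = a • (1 ⊗ₜ[R] b - b ⊗ₜ[R] 1) := rfl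
      rw [LinearMap.comp_apply, h2, map_smul, map_sub]
      change a • ((1 : S) ⊗ₜ[R] N.mkQ b - b ⊗ₜ[R] N.mkQ 1) = a ⊗ₜ[R] N.mkQ b
      rw [h1, TensorProduct.tmul_zero, sub_zero, TensorProduct.smul_tmul']
      simp
  have : Module.Flat S (S ⊗[R] (S ⧸ N)) := Module.Flat.of_retract σ m hσ
  exact Module.Flat.of_flat_tensorProduct R (S ⧸ N) S

end Algebra

/-! ### Generation of the derived category by `R` -/

section Generation

open DerivedCategory HomologicalComplex

variable {R : Type u} [CommRing R]

/-- Every complex receives a morphism from a coproduct of shifted copies of `R` that is surjective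
in homology. -/
lemma exists_surjective_homology (K : CochainComplex (ModuleCat.{u} R) ℤ) :
    ∃ f : (∐ fun p : (Σ n : ℤ, K.cycles n) =>
        (single _ (ComplexShape.up ℤ) p.1).obj (ModuleCat.of R R)) ⟶ K,
      ∀ n, Epi (homologyMap f n) := by
  let L : (Σ n : ℤ, K.cycles n) → CochainComplex (ModuleCat.{u} R) ℤ := fun p =>
    (single _ (ComplexShape.up ℤ) p.1).obj (ModuleCat.of R R)
  let α : ∀ p : (Σ n : ℤ, K.cycles n), ModuleCat.of R R ⟶ K.cycles p.1 := fun p =>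
    ModuleCat.ofHom (LinearMap.toSpanSingleton R (K.cycles p.1) p.2)
  let φ : ∀ p, L p ⟶ K := fun p => mkHomFromSingle (α p ≫ K.iCycles p.1) fun k _ => by simp
  have hφ : ∀ p, (singleObjCyclesSelfIso (ComplexShape.up ℤ) p.1 (ModuleCat.of R R)).inv ≫
      cyclesMap (φ p) p.1 = α p := fun p => by
    rw [← cancel_mono (K.iCycles p.1), Category.assoc, cyclesMap_i, ← Category.assoc,
      singleObjCyclesSelfIso_inv_iCycles, mkHomFromSingle_f, Iso.inv_hom_id_assoc]
  refine ⟨Sigma.desc φ, fun n => ?_⟩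
  rw [ModuleCat.epi_iff_surjective]
  intro x
  obtain ⟨z, rfl⟩ := (ModuleCat.epi_iff_surjective (K.homologyπ n)).1 inferInstance x
  let p : Σ n : ℤ, K.cycles n := ⟨n, z⟩
  have h1 : (singleObjCyclesSelfIso (ComplexShape.up ℤ) n (ModuleCat.of R R)).inv ≫
      (L p).homologyπ n ≫ homologyMap (Sigma.ι L p) n ≫ homologyMap (Sigma.desc φ) n =
        α p ≫ K.homologyπ n := by
    rw [← homologyMap_comp, Sigma.ι_desc, homologyπ_naturality, ← Category.assoc]
    exact congrArg (· ≫ K.homologyπ n) (hφ p)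
  have h2 := ConcreteCategory.congr_hom h1 (1 : R)
  simp only [ConcreteCategory.comp_apply] at h2
  refine ⟨_, h2.trans ?_⟩
  congr 1
  exact one_smul R z

variable [HasDerivedCategory.{w} (ModuleCat.{u} R)]

/-- The derived category is generated by `R` as a localizing subcategory. -/
lemma IsLocalizing.prop_of_prop_ring {P : ObjectProperty (DerivedCategory (ModuleCat.{u} R))}
    (hP : IsLocalizing P) (hR : P (moduleObj R R)) (X : DerivedCategory (ModuleCat.{u} R)) :
    P X := by
  have := hP.isTriangulated
  have := hP.isClosedUnderIsomorphisms
  have hsingle : ∀ n : ℤ, P ((singleFunctor (ModuleCat.{u} R) n).obj (ModuleCat.of R R)) :=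
    fun n => P.prop_of_iso
      (((singleFunctors (ModuleCat.{u} R)).shiftIso (-n) n 0 (by simp)).app (ModuleCat.of R R))
      (P.le_shift (-n) _ hR)
  refine hP.prop_of_approximation (fun X => ?_) X
  obtain ⟨f, hf⟩ := exists_surjective_homology (Q.objPreimage X)
  refine ⟨_, Q.map f ≫ (Q.objObjPreimageIso X).hom,
    hP.prop_cofan (isColimitQCofan (coproductIsCoproduct _)) fun p => hsingle p.1, fun n => ?_⟩
  have : Epi ((homologyFunctor _ n).map (Q.map f)) :=
    ((MorphismProperty.epimorphisms (ModuleCat.{u} R)).arrow_mk_iso_iff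
      (((Functor.mapArrowFunctor _ _).mapIso
        (homologyFunctorFactors (ModuleCat.{u} R) n)).app (Arrow.mk f))).2 (hf n)
  rw [Functor.map_comp]
  infer_instance

end Generation

end PureDerived

end

noncomputable section

namespace PureDerived

/-! ### Tensoring a complex with short exact sequences of modules -/

section TensorComplex

open HomologicalComplex MonoidalCategory

variable {R : Type u} [CommRing R]

/-- The functor `M ↦ E ⊗ M` from modules to complexes. -/
def tensorComplex (E : CochainComplex (ModuleCat.{u} R) ℤ) :
    ModuleCat.{u} R ⥤ CochainComplex (ModuleCat.{u} R) ℤ where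
  obj M := ((tensorRight M).mapHomologicalComplex _).obj E
  map f :=
    { f := fun i => E.X i ◁ f
      comm' := fun i j _ => whisker_exchange _ _ }
  map_id M := by
    ext1 i
    exact MonoidalCategory.whiskerLeft_id _ _
  map_comp f g := by
    ext1 i
    exact MonoidalCategory.whiskerLeft_comp _ _ _

variable (E : CochainComplex (ModuleCat.{u} R) ℤ)

instance preservesCoproducts_tensorComplex (ι : Type u) :
    PreservesColimitsOfShape (Discrete ι) (tensorComplex E) := by
  have h : ∀ i, PreservesColimitsOfShape (Discrete ι)
      (tensorComplex E ⋙ HomologicalComplex.eval _ _ i) := fun i =>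
    inferInstanceAs (PreservesColimitsOfShape (Discrete ι) (tensorLeft (E.X i)))
  exact HomologicalComplex.preservesColimitsOfShape_of_eval _ h

instance tensorComplex_additive : (tensorComplex E).Additive where
  map_add {_ _ f g} := by
    ext1 i
    exact MonoidalPreadditive.whiskerLeft_add _ _

lemma tensorComplex_shortExact {S : ShortComplex (ModuleCat.{u} R)} (hS : S.ShortExact)
    [Module.Flat R S.X₃] : (S.map (tensorComplex E)).ShortExact := by
  refine HomologicalComplex.shortExact_of_degreewise_shortExact _ fun i => ?_
  have hS' := ShortComplex.ShortExact.moduleCat_exact_iff_function_exact S |>.1 hS.exact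
  have hf := hS.moduleCat_injective_f
  have hg := hS.moduleCat_surjective_g
  refine ShortComplex.ShortExact.mk' ?_ ?_ ?_
  · rw [ShortComplex.ShortExact.moduleCat_exact_iff_function_exact]
    exact lTensor_exact (E.X i) hS' hg
  · exact (ModuleCat.mono_iff_injective _).2
      (LinearMap.lTensor_injective_of_exact_of_flat S.g.hom hg S.f.hom hf hS' (E.X i))
  · exact (ModuleCat.epi_iff_surjective _).2 (LinearMap.lTensor_surjective (E.X i) hg)

/-- The canonical map from `Z ⊗ M` to the cycles of `E ⊗ M`, where `Z` are the cycles of `E`. -/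
def tensorCycles (M : ModuleCat.{u} R) (n : ℤ) :
    E.cycles n ⊗ M ⟶ ((tensorComplex E).obj M).cycles n :=
  ((tensorComplex E).obj M).liftCycles (E.iCycles n ▷ M) (n + 1) (by simp) (by
    change E.iCycles n ▷ M ≫ E.d n (n + 1) ▷ M = 0
    rw [← comp_whiskerRight, iCycles_d, MonoidalPreadditive.zero_whiskerRight])

lemma tensorCycles_i (M : ModuleCat.{u} R) (n : ℤ) :
    tensorCycles E M n ≫ ((tensorComplex E).obj M).iCycles n = E.iCycles n ▷ M :=
  liftCycles_i _ _ _ _ _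

lemma epi_tensorCycles (M : ModuleCat.{u} R) [Module.Flat R M] (n : ℤ) :
    Epi (tensorCycles E M n) := by
  have h1 : (ShortComplex.mk (E.iCycles n) (E.d n (n + 1)) (E.iCycles_d _ _)).Exact :=
    ShortComplex.exact_of_f_is_kernel _ (E.cyclesIsKernel n (n + 1) (by simp))
  have h2 := ShortComplex.ShortExact.moduleCat_exact_iff_function_exact _ |>.1
    (Module.Flat.rTensor_shortComplex_exact M _ h1)
  rw [ModuleCat.epi_iff_surjective]
  intro z
  obtain ⟨y, hy⟩ := (h2 (((tensorComplex E).obj M).iCycles n z)).1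
    (ConcreteCategory.congr_hom (((tensorComplex E).obj M).iCycles_d n (n + 1)) z)
  refine ⟨y, (ModuleCat.mono_iff_injective (((tensorComplex E).obj M).iCycles n)).1
    inferInstance (Eq.trans ?_ hy)⟩
  exact ConcreteCategory.congr_hom (tensorCycles_i E M n) y

/-- As `M` is flat, cycles of `E ⊗ M` come from `Z ⊗ M`, with `Z` the cycles of `E`, and lift to `Z
⊗ N` by right exactness. This is what makes the connecting morphisms ghosts. -/
lemma epi_homologyMap_tensorComplex {N M : ModuleCat.{u} R} (f : N ⟶ M) [Epi f]
    [Module.Flat R M] (n : ℤ) : Epi (homologyMap ((tensorComplex E).map f) n) := by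
  have h1 : tensorCycles E N n ≫ cyclesMap ((tensorComplex E).map f) n =
      E.cycles n ◁ f ≫ tensorCycles E M n := by
    rw [← cancel_mono (((tensorComplex E).obj M).iCycles n), Category.assoc, cyclesMap_i,
      Category.assoc, tensorCycles_i, ← Category.assoc, tensorCycles_i]
    exact (whisker_exchange _ _).symm
  have h2 : (tensorCycles E N n ≫ ((tensorComplex E).obj N).homologyπ n) ≫
      homologyMap ((tensorComplex E).map f) n =
        E.cycles n ◁ f ≫ tensorCycles E M n ≫ ((tensorComplex E).obj M).homologyπ n := by
    rw [Category.assoc, homologyπ_naturality, ← Category.assoc, h1, Category.assoc]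
  have h3 : Epi (E.cycles n ◁ f) := (ModuleCat.epi_iff_surjective _).2
    (LinearMap.lTensor_surjective _ ((ModuleCat.epi_iff_surjective f).1 inferInstance))
  have := epi_tensorCycles E M n
  have h4 : Epi ((tensorCycles E N n ≫ ((tensorComplex E).obj N).homologyπ n) ≫
      homologyMap ((tensorComplex E).map f) n) := by
    rw [h2]
    infer_instance
  exact epi_of_epi (tensorCycles E N n ≫ ((tensorComplex E).obj N).homologyπ n) _

end TensorComplex

/-! ### Free covers and syzygies -/

section Syzygy

variable {R : Type u} [CommRing R]

/-- The canonical surjection from a free module. -/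
def freeπ (M : ModuleCat.{u} R) : ModuleCat.of R (M →₀ R) ⟶ M :=
  ModuleCat.ofHom (Finsupp.linearCombination R (id : M → M))

/-- The kernel of the canonical surjection from a free module. -/
def syzygy (M : ModuleCat.{u} R) : ModuleCat.{u} R :=
  ModuleCat.of R (LinearMap.ker (freeπ M).hom)

/-- The inclusion of the syzygy module. -/
def syzygyι (M : ModuleCat.{u} R) : syzygy M ⟶ ModuleCat.of R (M →₀ R) :=
  ModuleCat.ofHom (Submodule.subtype _)

lemma freeπ_surjective (M : ModuleCat.{u} R) : Function.Surjective (freeπ M).hom :=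
  Finsupp.linearCombination_surjective R Function.surjective_id

lemma syzygyι_injective (M : ModuleCat.{u} R) : Function.Injective (syzygyι M).hom :=
  Submodule.subtype_injective _

lemma exact_syzygyι_freeπ (M : ModuleCat.{u} R) :
    Function.Exact (syzygyι M).hom (freeπ M).hom :=
  LinearMap.exact_subtype_ker_map _

lemma syzygyι_freeπ (M : ModuleCat.{u} R) : syzygyι M ≫ freeπ M = 0 := by
  ext1
  exact LinearMap.ext fun x => x.2

lemma shortExact_syzygyι_freeπ (M : ModuleCat.{u} R) :
    (ShortComplex.mk (syzygyι M) (freeπ M) (syzygyι_freeπ M)).ShortExact := by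
  refine ShortComplex.ShortExact.mk' ?_ ?_ ?_
  · rw [ShortComplex.ShortExact.moduleCat_exact_iff_function_exact]
    exact exact_syzygyι_freeπ M
  · exact (ModuleCat.mono_iff_injective _).2 (syzygyι_injective M)
  · exact (ModuleCat.epi_iff_surjective _).2 (freeπ_surjective M)

instance flat_syzygy (M : ModuleCat.{u} R) [Module.Flat R M] :
    Module.Flat R (syzygy M) :=
  flat_of_exact (syzygyι M).hom (freeπ M).hom (syzygyι_injective M) (freeπ_surjective M)
    (exact_syzygyι_freeπ M)

/-- The inclusion of a copy of `R` into a free module. -/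
def freeInj {K : Type u} (k : K) : ModuleCat.of R R ⟶ ModuleCat.of R (K →₀ R) :=
  ModuleCat.ofHom (Finsupp.lsingle k)

/-- The module of finitely supported functions is a coproduct of copies of `R`. -/
def isColimitFinsupp (K : Type u) :
    IsColimit (Cofan.mk (ModuleCat.of R (K →₀ R)) fun k : K => freeInj (R := R) k) :=
  Cofan.IsColimit.mk _ (fun t => ModuleCat.ofHom (Finsupp.lsum R fun k => (t.inj k).hom))
    (fun t k => by
      ext1
      refine LinearMap.ext_ring ?_
      exact (Finsupp.lsum_single R (fun k => (t.inj k).hom) k (1 : R)))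
    (fun t m hm => by
      ext1
      refine Finsupp.lhom_ext' fun k => ?_
      refine (congrArg ModuleCat.Hom.hom (hm k)).trans ?_
      exact LinearMap.ext fun x => (Finsupp.lsum_single R (fun k => (t.inj k).hom) k x).symm)

end Syzygy

/-! ### Connecting morphisms are phantoms -/

section FlatExact

open DerivedCategory

variable {R : Type u} [CommRing R] [HasDerivedCategory.{w} (ModuleCat.{u} R)]

/-- A functor from modules to the derived category which preserves coproducts and sends short
exact sequences with flat cokernel to triangles that induce short exact sequences in homology. -/
structure IsFlatExact (T : ModuleCat.{u} R ⥤ DerivedCategory (ModuleCat.{u} R)) : Prop where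
  coproducts (ι : Type u) : PreservesColimitsOfShape (Discrete ι) T
  triangle (S : ShortComplex (ModuleCat.{u} R)) (hS : S.ShortExact) [Module.Flat R S.X₃] :
    ∃ δ : T.obj S.X₃ ⟶ (T.obj S.X₁)⟦(1 : ℤ)⟧,
      Triangle.mk (T.map S.f) (T.map S.g) δ ∈ distTriang _ ∧ IsGhost δ

lemma isFlatExact_tensorComplex (E : CochainComplex (ModuleCat.{u} R) ℤ) :
    IsFlatExact (tensorComplex E ⋙ Q) where
  coproducts ι := inferInstance
  triangle S hS _ := by
    have hT := triangleOfSES_distinguished (tensorComplex_shortExact E hS)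
    refine ⟨triangleOfSESδ (tensorComplex_shortExact E hS), hT, fun n => ?_⟩
    have := hS.epi_g
    have h1 : Epi ((homologyFunctor _ n).map (Q.map ((tensorComplex E).map S.g))) :=
      ((MorphismProperty.epimorphisms (ModuleCat.{u} R)).arrow_mk_iso_iff
        (((Functor.mapArrowFunctor _ _).mapIso
          (homologyFunctorFactors (ModuleCat.{u} R) n)).app
            (Arrow.mk ((tensorComplex E).map S.g)))).2 (epi_homologyMap_tensorComplex E S.g n)
    have h2 := (HomologySequence.epi_homologyMap_mor₂_iff _ hT n (n + 1)).1 h1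
    have h3 : IsIso (((homologyFunctor (ModuleCat.{u} R) 0).shiftIso (1 : ℤ) n (n + 1)
        (add_comm _ _)).hom.app (Q.obj ((tensorComplex E).obj S.X₁))) := inferInstance
    exact (@Preadditive.IsIso.comp_right_eq_zero _ _ _ _ _ _ _ _ h3).1 h2

lemma IsGhost.shift {X Y : DerivedCategory (ModuleCat.{u} R)} {f : X ⟶ Y} (hf : IsGhost f) :
    IsGhost (f⟦(1 : ℤ)⟧') := fun n => by
  have h := (homologyFunctor (ModuleCat.{u} R) 0).shiftIso_hom_naturality (1 : ℤ) n (n + 1)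
    (add_comm _ _) f
  have h0 : ((homologyFunctor (ModuleCat.{u} R) 0).shift (n + 1)).map f = 0 := hf (n + 1)
  rw [h0, comp_zero] at h
  have h1 : IsIso (((homologyFunctor (ModuleCat.{u} R) 0).shiftIso (1 : ℤ) n (n + 1)
      (add_comm _ _)).hom.app Y) := inferInstance
  exact (@Preadditive.IsIso.comp_right_eq_zero _ _ _ _ _ _ _ _ h1).1 h

lemma IsFlatExact.shift {T : ModuleCat.{u} R ⥤ DerivedCategory (ModuleCat.{u} R)}
    (hT : IsFlatExact T) : IsFlatExact (T ⋙ shiftFunctor _ (1 : ℤ)) where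
  coproducts ι := by
    have := hT.coproducts ι
    infer_instance
  triangle S hS _ := by
    obtain ⟨δ, h, hδ⟩ := hT.triangle S hS
    refine ⟨-δ⟦(1 : ℤ)⟧', ?_, fun n => ?_⟩
    · refine isomorphic_distinguished _
        (rot_of_distTriang _ (rot_of_distTriang _ (rot_of_distTriang _ h))) _ ?_
      -- Three rotations negate all three morphisms; the sign in the middle absorbs the first two,
      -- and the third stays in `-δ⟦1⟧'`.
      refine Triangle.isoMk _ _ (Iso.refl _) (-Iso.refl _) (Iso.refl _) ?_ ?_ ?_
      · change (T.map S.f)⟦(1 : ℤ)⟧' ≫ (-𝟙 _) = 𝟙 _ ≫ (-(T.map S.f)⟦(1 : ℤ)⟧')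
        simp
      · change (T.map S.g)⟦(1 : ℤ)⟧' ≫ 𝟙 _ = (-𝟙 _) ≫ (-(T.map S.g)⟦(1 : ℤ)⟧')
        simp
      · change (-δ⟦(1 : ℤ)⟧') ≫ (𝟙 _)⟦(1 : ℤ)⟧' = 𝟙 _ ≫ (-δ⟦(1 : ℤ)⟧')
        simp
    · exact (Functor.map_neg _).trans (by rw [hδ.shift n, neg_zero])

variable {T : ModuleCat.{u} R ⥤ DerivedCategory (ModuleCat.{u} R)}
  {A : DerivedCategory (ModuleCat.{u} R)}

/-- The inductive step: `z` has finite support by compactness, and some `ρ` retracts `syzygyι M` on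
that support, so `x ≫ δ` is unchanged by `T.map (syzygyι M ≫ ρ)` shifted. But `δ` composed with the
shift of `T.map (syzygyι M)` is zero. -/
lemma IsFlatExact.exists_lift_of_exists_lift (hT : IsFlatExact T) (hA : IsCompactObject A)
    (M : ModuleCat.{u} R) [Module.Flat R M]
    {δ : T.obj M ⟶ (T.obj (syzygy M))⟦(1 : ℤ)⟧}
    (hδ : Triangle.mk (T.map (syzygyι M)) (T.map (freeπ M)) δ ∈ distTriang _)
    (x : A ⟶ T.obj M)
    (hx : ∃ z, x ≫ δ = z ≫ (T.map (freeπ (syzygy M)))⟦(1 : ℤ)⟧') :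
    ∃ y, x = y ≫ T.map (freeπ M) := by
  refine exists_lift₂ hδ x ?_
  obtain ⟨z, hz⟩ := hx
  have := hT.shift.coproducts (syzygy M)
  obtain ⟨s, hs⟩ := hA.exists_eq_sum
    (isColimitCofanMkObjOfIsColimit (T ⋙ shiftFunctor _ (1 : ℤ)) _ _
      (isColimitFinsupp (R := R) (syzygy M))) z
  obtain ⟨r, hr⟩ := exists_linearMap_fixing_finset (M := M)
    (syzygyι M).hom (freeπ M).hom (syzygyι_injective M) (freeπ_surjective M)
    (exact_syzygyι_freeπ M) s
  let ρ : ModuleCat.of R (M →₀ R) ⟶ (syzygy M) := ModuleCat.ofHom r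
  have h1 : z ≫ (T.map (freeπ (syzygy M)))⟦(1 : ℤ)⟧' ≫
      (T.map (syzygyι M ≫ ρ))⟦(1 : ℤ)⟧' =
        z ≫ (T.map (freeπ (syzygy M)))⟦(1 : ℤ)⟧' := by
    rw [hs, Preadditive.sum_comp, Preadditive.sum_comp]
    refine Finset.sum_congr rfl fun k hk => ?_
    have h2 : (freeInj k ≫ freeπ (syzygy M)) ≫
        syzygyι M ≫ ρ =
          freeInj k ≫ freeπ (syzygy M) := by
      ext1
      refine LinearMap.ext_ring ?_
      have h3 : (Finsupp.linearCombination R (id : (syzygy M) → _))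
          (Finsupp.single k 1) = k := by simp
      refine Eq.trans ?_ ((hr k hk).trans h3.symm)
      exact congrArg (fun a => r ((syzygyι M).hom a)) h3
    have h4 := congrArg (T ⋙ shiftFunctor _ (1 : ℤ)).map h2
    rw [Functor.map_comp, Functor.map_comp, Category.assoc] at h4
    exact (Category.assoc _ _ _).trans ((congrArg (_ ≫ ·) h4).trans (Category.assoc _ _ _).symm)
  rw [hz, ← h1, ← Category.assoc, ← hz, Functor.map_comp, Functor.map_comp, Category.assoc,
    ← Category.assoc δ, comp_eq_zero₃₁ hδ, zero_comp, comp_zero]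

/-- Morphisms from a compact object to the value of `T` at a flat module factor through the value
of `T` at a free module. -/
lemma IsFlatExact.exists_lift (hT : IsFlatExact T) (hA : IsCompactObject A)
    (M : ModuleCat.{u} R) [Module.Flat R M] (x : A ⟶ T.obj M) :
    ∃ y, x = y ≫ T.map (freeπ M) := by
  by_contra hx
  -- The states are all counterexamples, with `T` varying because each step replaces it by its
  -- shift.
  let St := {s : Σ (T : ModuleCat.{u} R ⥤ DerivedCategory (ModuleCat.{u} R))
    (M : ModuleCat.{u} R), (A ⟶ T.obj M) // IsFlatExact s.1 ∧ Module.Flat R s.2.1 ∧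
      ¬ ∃ y, s.2.2 = y ≫ s.1.map (freeπ s.2.1)}
  have hstep : ∀ s : St, ∃ (s' : St) (g : s.1.1.obj s.1.2.1 ⟶ s'.1.1.obj s'.1.2.1),
      IsGhost g ∧ s'.1.2.2 = s.1.2.2 ≫ g := by
    rintro ⟨⟨T, M, x⟩, hT, hM, hx⟩
    obtain ⟨δ, h, hδ⟩ := hT.triangle _ (shortExact_syzygyι_freeπ M)
    exact ⟨⟨⟨T ⋙ shiftFunctor _ (1 : ℤ), (syzygy M), x ≫ δ⟩, hT.shift, inferInstance,
      fun hz => hx (hT.exists_lift_of_exists_lift hA M h x hz)⟩, δ, hδ, rfl⟩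
  choose next g hg hgx using hstep
  let st : ℕ → St := fun n => Nat.rec ⟨⟨T, M, x⟩, hT, inferInstance, hx⟩ (fun _ s => next s) n
  obtain ⟨n, hn⟩ := hA.exists_eq_zero_of_isGhost (X := fun n => (st n).1.1.obj (st n).1.2.1)
    (f := fun n => g (st n)) (fun n => hg (st n)) (fun n => (st n).1.2.2) fun n => hgx (st n)
  exact (st n).2.2.2 ⟨0, hn.trans zero_comp.symm⟩

/-- The connecting morphism attached to a short exact sequence with flat cokernel is a phantom. -/
lemma IsFlatExact.isPhantom (hT : IsFlatExact T) {S : ShortComplex (ModuleCat.{u} R)}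
    (hS : S.ShortExact) [Module.Flat R S.X₃] {δ : T.obj S.X₃ ⟶ (T.obj S.X₁)⟦(1 : ℤ)⟧}
    (hδ : Triangle.mk (T.map S.f) (T.map S.g) δ ∈ distTriang _) : IsPhantom δ := by
  intro A hA x
  obtain ⟨y, rfl⟩ := hT.exists_lift hA S.X₃ x
  have := hS.epi_g
  have : Projective (ModuleCat.of R (S.X₃ →₀ R)) :=
    (IsProjective.iff_projective _).1 (inferInstanceAs (Module.Projective R (S.X₃ →₀ R)))
  -- The free cover of `S.X₃` lifts through `S.g`, which `δ` annihilates.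
  have h : T.map (freeπ S.X₃) = T.map (Projective.factorThru (freeπ S.X₃) S.g) ≫
      T.map S.g := by
    rw [← T.map_comp, Projective.factorThru_comp]
  rw [h, Category.assoc, Category.assoc, comp_eq_zero₂₃ hδ, comp_zero, comp_zero]

end FlatExact

end PureDerived

end

noncomputable section

namespace PureDerived

open DerivedCategory HomologicalComplex MonoidalCategory

/-! ### Derived tensor product with a flat module -/

section TensorDerived

variable {R : Type u} [CommRing R] [HasDerivedCategory.{w} (ModuleCat.{u} R)]
  (M : ModuleCat.{u} R) [Module.Flat R M]

instance preservesFiniteColimits_tensorRight (N : ModuleCat.{u} R) :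
    PreservesFiniteColimits (tensorRight N) :=
  preservesFiniteColimits_of_natIso (BraidedCategory.tensorLeftIsoTensorRight N)

/-- The derived tensor product with a flat module. -/
def derivedTensor : DerivedCategory (ModuleCat.{u} R) ⥤ DerivedCategory (ModuleCat.{u} R) :=
  (tensorRight M).mapDerivedCategory

instance commShift_derivedTensor : (derivedTensor M).CommShift ℤ :=
  inferInstanceAs ((tensorRight M).mapDerivedCategory.CommShift ℤ)

instance isTriangulated_derivedTensor : (derivedTensor M).IsTriangulated :=
  inferInstanceAs (tensorRight M).mapDerivedCategory.IsTriangulated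

/-- The derived tensor product with a flat module can be computed on complexes. -/
def derivedTensorObjIso (E : CochainComplex (ModuleCat.{u} R) ℤ) :
    (derivedTensor M).obj (Q.obj E) ≅ Q.obj ((tensorComplex E).obj M) :=
  (tensorRight M).mapDerivedCategoryFactors.app E

instance preservesCoproducts_derivedTensor (ι : Type u) :
    PreservesColimitsOfShape (Discrete ι) (derivedTensor M) := by
  have h1 : PreservesColimitsOfShape (Discrete ι)
      ((tensorRight M).mapHomologicalComplex (ComplexShape.up ℤ)) := by
    refine HomologicalComplex.preservesColimitsOfShape_of_eval _ fun i => ?_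
    have : PreservesColimitsOfShape (Discrete ι) (tensorRight M) :=
      preservesColimitsOfShape_of_natIso (BraidedCategory.tensorLeftIsoTensorRight M)
    exact inferInstanceAs (PreservesColimitsOfShape (Discrete ι)
      (HomologicalComplex.eval _ (ComplexShape.up ℤ) i ⋙ tensorRight M))
  have h2 : PreservesColimitsOfShape (Discrete ι)
      ((Q : CochainComplex (ModuleCat.{u} R) ℤ ⥤ _) ⋙ derivedTensor M) :=
    preservesColimitsOfShape_of_natIso (tensorRight M).mapDerivedCategoryFactors.symm
  have h3 : ∀ K : ι → CochainComplex (ModuleCat.{u} R) ℤ,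
      PreservesColimit (Discrete.functor K ⋙ Q) (derivedTensor M) := fun K =>
    preservesColimit_of_preserves_colimit_cocone
      (isColimitOfPreserves Q (colimit.isColimit (Discrete.functor K)))
      (isColimitOfPreserves (Q ⋙ derivedTensor M) (colimit.isColimit (Discrete.functor K)))
  refine ⟨fun {F} => ?_⟩
  have := h3 fun i => Q.objPreimage (F.obj ⟨i⟩)
  exact preservesColimit_of_iso_diagram (derivedTensor M)
    (Discrete.natIso fun i => Q.objObjPreimageIso (F.obj i) :
      Discrete.functor (fun i => Q.objPreimage (F.obj ⟨i⟩)) ⋙ Q ≅ F)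

lemma IsLocalizing.inverseImage_derivedTensor
    {P : ObjectProperty (DerivedCategory (ModuleCat.{u} R))} (hP : IsLocalizing P) :
    IsLocalizing (P.inverseImage (derivedTensor M)) where
  isTriangulated := by
    have := hP.isTriangulated
    have := hP.isClosedUnderIsomorphisms
    infer_instance
  isClosedUnderIsomorphisms := by
    have := hP.isClosedUnderIsomorphisms
    infer_instance
  coproducts ι := by
    have := hP.coproducts ι
    infer_instance

/-- A localizing subcategory that contains a flat module contains all tensor products with it. -/
lemma IsLocalizing.prop_derivedTensor {P : ObjectProperty (DerivedCategory (ModuleCat.{u} R))}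
    (hP : IsLocalizing P) (hM : P (moduleObj R M)) (X : DerivedCategory (ModuleCat.{u} R)) :
    P ((derivedTensor M).obj X) := by
  have := hP.isClosedUnderIsomorphisms
  refine (hP.inverseImage_derivedTensor M).prop_of_prop_ring ?_ X
  refine P.prop_of_iso ?_ hM
  exact (((tensorRight M).mapDerivedCategorySingleFunctor 0).app (ModuleCat.of R R) ≪≫
    (singleFunctor _ 0).mapIso (λ_ M)).symm

/-- Tensoring a complex with the base ring does not change it. -/
def tensorComplexUnitIso (E : CochainComplex (ModuleCat.{u} R) ℤ) :
    (tensorComplex E).obj (ModuleCat.of R R) ≅ E :=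
  HomologicalComplex.Hom.isoOfComponents (fun i => ρ_ (E.X i)) fun i j _ =>
    (rightUnitor_naturality (E.d i j)).symm

end TensorDerived

/-! ### Pure-injectives and faithfully flat algebras -/

section FaithfullyFlat

variable {R : Type u} [CommRing R] (S : Type u) [CommRing S] [Algebra R S]
  [Module.FaithfullyFlat R S]

/-- The short exact sequence `0 ⟶ R ⟶ S ⟶ S/R ⟶ 0` of a faithfully flat ring homomorphism. -/
def quotientComplex (R : Type u) [CommRing R] (S : Type u) [CommRing S] [Algebra R S] :
    ShortComplex (ModuleCat.{u} R) where
  X₁ := ModuleCat.of R R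
  X₂ := ModuleCat.of R S
  X₃ := ModuleCat.of R (S ⧸ LinearMap.range (Algebra.linearMap R S))
  f := ModuleCat.ofHom (Algebra.linearMap R S)
  g := ModuleCat.ofHom (LinearMap.range (Algebra.linearMap R S)).mkQ
  zero := by
    ext1
    exact LinearMap.range_mkQ_comp _

lemma quotientComplex_shortExact : (quotientComplex R S).ShortExact := by
  refine ShortComplex.ShortExact.mk' ?_ ?_ ?_
  · rw [ShortComplex.ShortExact.moduleCat_exact_iff_function_exact]
    exact LinearMap.exact_map_mkQ_range _
  · exact (ModuleCat.mono_iff_injective _).2 (FaithfulSMul.algebraMap_injective R S)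
  · exact (ModuleCat.epi_iff_surjective _).2 (Submodule.mkQ_surjective _)

instance flat_quotientComplex : Module.Flat R (quotientComplex R S).X₃ :=
  flat_quotient_of_faithfullyFlat S

variable [HasDerivedCategory.{w} (ModuleCat.{u} R)]

/-- Pure monomorphisms are invariant under isomorphisms. -/
lemma isPureMono_of_iso {X Y Z X' Y' : DerivedCategory (ModuleCat.{u} R)} {f : X ⟶ Y} {g : Y ⟶ Z}
    {δ : Z ⟶ X⟦(1 : ℤ)⟧} (h : IsPureTriangle (Triangle.mk f g δ)) (a : X ≅ X') (b : Y ≅ Y') :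
    IsPureMono (a.inv ≫ f ≫ b.hom) := by
  refine ⟨Z, b.inv ≫ g, δ ≫ a.hom⟦(1 : ℤ)⟧', ?_, fun C hC x => ?_⟩
  · refine isomorphic_distinguished _ h.1 _ ?_
    refine Triangle.isoMk _ _ a.symm b.symm (Iso.refl _) ?_ ?_ ?_
    · change (a.inv ≫ f ≫ b.hom) ≫ b.inv = a.inv ≫ f
      simp
    · change (b.inv ≫ g) ≫ 𝟙 _ = b.inv ≫ g
      simp
    · change (δ ≫ a.hom⟦(1 : ℤ)⟧') ≫ a.inv⟦(1 : ℤ)⟧' = 𝟙 _ ≫ δ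
      rw [Category.assoc, ← Functor.map_comp, a.hom_inv_id, CategoryTheory.Functor.map_id, Category.comp_id,
        Category.id_comp]
  · have hx : (show C ⟶ Z from x) ≫ δ = 0 := h.2 C hC x
    exact (Category.assoc _ _ _).symm.trans ((congrArg (· ≫ _) hx).trans zero_comp)

/-- Pure-injective objects are retracts of their tensor product with a faithfully flat algebra. -/
lemma IsPureInjective.exists_retract {X : DerivedCategory (ModuleCat.{u} R)}
    (hX : IsPureInjective X) : ∃ (i : X ⟶ (derivedTensor (ModuleCat.of R S)).obj X)
      (r : (derivedTensor (ModuleCat.of R S)).obj X ⟶ X), i ≫ r = 𝟙 X := by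
  let E := Q.objPreimage X
  let e : Q.obj E ≅ X := Q.objObjPreimageIso X
  let a : Q.obj ((tensorComplex E).obj (ModuleCat.of R R)) ≅ X :=
    Q.mapIso (tensorComplexUnitIso E) ≪≫ e
  let b : Q.obj ((tensorComplex E).obj (ModuleCat.of R S)) ≅
      (derivedTensor (ModuleCat.of R S)).obj X :=
    (derivedTensorObjIso _ E).symm ≪≫ (derivedTensor (ModuleCat.of R S)).mapIso e
  have hT := isFlatExact_tensorComplex E
  obtain ⟨δ, hδ, -⟩ := hT.triangle _ (quotientComplex_shortExact (R := R) S)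
  have hp := hT.isPhantom (quotientComplex_shortExact (R := R) S) hδ
  have hmono := isPureMono_of_iso ⟨hδ, hp⟩ a b
  obtain ⟨⟨r, hr⟩⟩ := hX _ _ hmono
  exact ⟨_, r, hr⟩

end FaithfullyFlat

end PureDerived

end

theorem mainTheorem6 (R : Type u) [CommRing R] [HasDerivedCategory.{w} (ModuleCat.{u} R)]
    (hR : PureDerived.Loc (PureDerived.pureInjectives R) = ⊤)
    (S : Type u) [CommRing S] [Algebra R S] [Module.FaithfullyFlat R S] :
    PureDerived.Loc (ObjectProperty.singleton (PureDerived.moduleObj R S)) = ⊤ := by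
  refine top_le_iff.1 fun X _ P hP hS => ?_
  have hX : PureDerived.Loc (PureDerived.pureInjectives R) X := by
    rw [hR]
    trivial
  refine hX P hP fun Y hY => ?_
  obtain ⟨i, r, hir⟩ := PureDerived.IsPureInjective.exists_retract S hY
  exact hP.prop_of_retract i r hir
    (hP.prop_derivedTensor (ModuleCat.of R S) (ObjectProperty.singleton_le_iff.1 hS) Y)
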